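/- Let $(X,d)$ be a metric space, let $(\widetilde X,\widetilde d)$ be a completion of $(X,d)$ (with $X$ regarded as a dense subspace of the complete metric space $\widetilde X$), and let $1\le p<\infty$. For a metric space $Z$, a fuzzy set in $Z$ is a function $u:Z\to[0,1]$; its cuts are $[u]_\alpha=\{z\in Z:u(z)\ge\alpha\}$ for $\alpha\in(0,1]$ and $[u]_0=\overline{\{z\in Z:u(z)>0\}}$. Let $K(Z)$ be the family of nonempty compact subsets of $Z$, $H$ the Hausdorff distance, and $\widehat z$ the characteristic function of $\{z\}$. Put $$F^1_{USCB}(Z)=\{u:[u]_\alpha\in K(Z)\ \forall\alpha\in[0,1]\},\qquad F^1_{USCG}(Z)=\{u:[u]_\alpha\in K(Z)\ \forall\alpha\in(0,1]\},$$ $$d_p(u,v)=\Big(\int_0^1 H([u]_\alpha,[v]_\alpha)^p\,d\alpha\Big)^{1/p},\qquad F^1_{USCG}(Z)^p=\{u\in F^1_{USCG}(Z): d_p(u,\widehat{z_0})<\infty\},$$ where $z_0$ is some point of $Z$ (the choice of $z_0$ is immaterial). Fuzzy sets in $X$ are regarded as fuzzy sets in $\widetilde X$ by extending them by $0$ on $\widetilde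 X\setminus X$. Then, for $Z=X$ and for $Z=\widetilde X$, the function $\alpha\mapsto H([u]_\alpha,[v]_\alpha)$ is measurable on $[0,1]$ for all $u,v\in F^1_{USCG}(Z)$, so that $d_p$ is well defined there. Moreover, $d_p$ is a metric on each of $F^1_{USCB}(X)$, $F^1_{USCG}(X)^p$ and $F^1_{USCG}(\widetilde X)^p$, and: 1. $(F^1_{USCG}(\widetilde X)^p,d_p)$ is a completion of $(F^1_{USCB}(X),d_p)$: it is complete, and extension by $0$ maps $F^1_{USCB}(X)$ isometrically onto a dense subset of it. 2. $(F^1_{USCG}(\widetilde X)^p,d_p)$ is a completion of $(F^1_{USCG}(X)^p,d_p)$, again through extension by $0$. -/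

import Mathlib

open MeasureTheory
open scoped ENNReal unitInterval

/-- A fuzzy set in `X` is a function `X → [0,1]`. -/
abbrev FuzzySet (X : Type*) := X → I

namespace FuzzySet

/-- The fuzzy set `x̂`, i.e. the characteristic function of `{x}`. -/
noncomputable def point {X : Type*} (x : X) : FuzzySet X :=
  Set.indicator {x} (fun _ => (1 : I))

/-- The `α`-cut `[u]_α` for `α ∈ [0,1]`: the set `{x | u x ≥ α}` for `α > 0`, and the
closure of `{x | u x > 0}` for `α = 0`. -/
noncomputable def cut {X : Type*} [TopologicalSpace X] (u : FuzzySet X) (α : ℝ) : Set X :=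
  if 0 < α then {x | α ≤ (u x : ℝ)} else closure {x | 0 < (u x : ℝ)}

/-- `F¹_USCB(X)`: all cuts `[u]_α`, `α ∈ [0,1]`, are nonempty and compact. -/
def USCB (X : Type*) [TopologicalSpace X] : Set (FuzzySet X) :=
  {u | ∀ α ∈ Set.Icc (0 : ℝ) 1, (cut u α).Nonempty ∧ IsCompact (cut u α)}

/-- `F¹_USCG(X)`: all cuts `[u]_α`, `α ∈ (0,1]`, are nonempty and compact. -/
def USCG (X : Type*) [TopologicalSpace X] : Set (FuzzySet X) :=
  {u | ∀ α ∈ Set.Ioc (0 : ℝ) 1, (cut u α).Nonempty ∧ IsCompact (cut u α)}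

/-- The function `α ↦ H([u]_α, [v]_α)` with `H` the (extended) Hausdorff distance. -/
noncomputable def cutDist {X : Type*} [MetricSpace X] (u v : FuzzySet X) (α : ℝ) : ℝ≥0∞ :=
  Metric.hausdorffEDist (cut u α) (cut v α)

/-- `d_p(u,v) = (∫_0^1 H([u]_α, [v]_α)^p dα)^(1/p)`, with values in `[0,∞]`. -/
noncomputable def dp {X : Type*} [MetricSpace X] (p : ℝ) (u v : FuzzySet X) : ℝ≥0∞ :=
  (∫⁻ α in Set.Icc (0 : ℝ) 1, cutDist u v α ^ p) ^ (1 / p)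

/-- `F¹_USCG(X)^p`: the members of `F¹_USCG(X)` at finite `d_p`-distance from a point of `X`. -/
def USCGp (X : Type*) [MetricSpace X] (p : ℝ) : Set (FuzzySet X) :=
  {u | u ∈ USCG X ∧ ∃ x₀ : X, dp p u (point x₀) < ∞}

/-- Extension of a fuzzy set by `0` along an (injective) map `ι : X → Y`. -/
noncomputable def extendZero {X Y : Type*} (ι : X → Y) (u : FuzzySet X) : FuzzySet Y :=
  Function.extend ι u (fun _ => (0 : I))

end FuzzySet

/-- `(B, ρB)` is a completion of `(A, ρA)` through the map `i : A → B`: both distance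
functions are (finite-valued) metrics, `i` preserves distances and has dense range, and
`(B, ρB)` is complete. -/
def IsMetricCompletion {A B : Type*} (ρA : A → A → ℝ≥0∞) (ρB : B → B → ℝ≥0∞)
    (i : A → B) : Prop :=
  ∃ (_ : MetricSpace A) (_ : MetricSpace B),
    (∀ a a' : A, edist a a' = ρA a a') ∧ (∀ b b' : B, edist b b' = ρB b b') ∧
      Isometry i ∧ DenseRange i ∧ CompleteSpace B

namespace FuzzySet

open Set Filter Topology Metric TopologicalSpace

/-! ### Cuts and the reconstruction of a fuzzy set from them -/

section Cuts

variable {X : Type*} [TopologicalSpace X]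

/-! A member of `USCG` amounts to a nested, left-continuous family of nonempty compact cuts over
(0,1], and `dp` is the L^p distance between such families for the Hausdorff metric; level 0 is null.
Left continuity comes from compactness (`exists_forall_hausdorffEDist_cut_le`) and gives
measurability through step functions. The metric axioms are then Minkowski's inequality and the fact
that almost all cuts determine a fuzzy set.

Completeness: along a rapidly Cauchy sequence the cuts at almost every level are Cauchy, hence
converge, as the compact subsets of a complete space are complete. The limits are nested, and a
nested family is left-continuous off a countable set of levels (`countable_setOf_iInter_ne`), so
almost everywhere they are the cuts of a fuzzy set. Fatou's lemma upgrades this to convergence in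
`dp`.

Density: truncating small values makes the support compact (`exists_mem_USCB_dp_lt`); the cuts at
finitely many levels are then replaced by finite subsets of X
(`exists_mem_USCB_forall_hausdorffEDist_le`). The approximants lie in `USCB X`, which settles both
completions at once. -/

theorem cut_of_pos (u : FuzzySet X) {α : ℝ} (h : 0 < α) : cut u α = {x | α ≤ (u x : ℝ)} :=
  if_pos h

theorem cut_zero (u : FuzzySet X) : cut u 0 = closure {x | 0 < (u x : ℝ)} :=
  if_neg (lt_irrefl 0)

theorem cut_anti (u : FuzzySet X) {α β : ℝ} (hα : 0 ≤ α) (h : α ≤ β) : cut u β ⊆ cut u α := by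
  rcases hα.eq_or_lt with rfl | hα
  · rcases h.eq_or_lt with rfl | h
    · exact subset_rfl
    · rw [cut_zero, cut_of_pos u h]
      exact fun x hx => subset_closure (lt_of_lt_of_le h hx)
  · rw [cut_of_pos u hα, cut_of_pos u (hα.trans_le h)]
    exact fun x hx => h.trans hx

/-- Cuts are determined by any family of cuts at smaller levels approaching the given one. -/
theorem mem_cut_of_forall_lt (u : FuzzySet X) {α : ℝ} (hα : 0 < α) {x : X}
    (h : ∀ β ∈ Ioo 0 α, x ∈ cut u β) : x ∈ cut u α := by
  rw [cut_of_pos u hα]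
  change α ≤ (u x : ℝ)
  refine le_of_forall_lt_imp_le_of_dense fun β hβ => ?_
  rcases le_or_gt β 0 with h0 | h0
  · exact h0.trans (u x).2.1
  · simpa [cut_of_pos u h0] using h β ⟨h0, hβ⟩

/-- If the values at x differ, a level of S strictly between them separates the cuts. Density of S
suffices, so equality of almost all cuts will do. -/
theorem ext_of_cut {u v : FuzzySet X} {S : Set ℝ} (hS : ∀ a b : ℝ, 0 ≤ a → a < b → b ≤ 1 →
    ∃ s ∈ S, s ∈ Ioo a b) (h : ∀ α ∈ S, α ∈ Ioc (0 : ℝ) 1 → cut u α = cut v α) : u = v := by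
  have key : ∀ u v : FuzzySet X, (∀ α ∈ S, α ∈ Ioc (0 : ℝ) 1 → cut u α = cut v α) →
      ∀ x, (u x : ℝ) ≤ v x := by
    intro u v h x
    by_contra! hlt
    obtain ⟨s, hs, hs'⟩ := hS _ _ (v x).2.1 hlt (u x).2.2
    have h0 : 0 < s := (v x).2.1.trans_lt hs'.1
    have h2 : x ∈ cut u s := by rw [cut_of_pos u h0]; exact hs'.2.le
    rw [h s hs ⟨h0, hs'.2.le.trans (u x).2.2⟩, cut_of_pos v h0] at h2
    exact absurd hs'.1 (not_lt.2 h2)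
  funext x
  exact Subtype.ext (le_antisymm (key u v h x) (key v u (fun α h1 h2 => (h α h1 h2).symm) x))

theorem USCB_subset_USCG : USCB X ⊆ USCG X := fun _ hu α hα => hu α ⟨hα.1.le, hα.2⟩

theorem cut_point [T1Space X] (x : X) {α : ℝ} (hα : α ∈ Icc (0 : ℝ) 1) :
    cut (point x) α = {x} := by
  classical
  have key : ∀ y, ((point x y : I) : ℝ) = if y = x then 1 else 0 := by
    intro y
    by_cases h : y = x <;> simp [point, h]
  rcases hα.1.eq_or_lt with rfl | h0
  · have : {y | 0 < ((point x y : I) : ℝ)} = {x} := by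
      ext y
      by_cases h : y = x <;> simp [key, h]
    rw [cut_zero, this, closure_singleton]
  · rw [cut_of_pos _ h0]
    ext y
    by_cases h : y = x <;> simp [key, h, hα.2, h0]

theorem point_mem_USCB [T1Space X] (x : X) : point x ∈ USCB X := fun α hα => by
  rw [cut_point x hα]
  exact ⟨singleton_nonempty x, isCompact_singleton⟩

/-- A nested family of nonempty compact sets, indexed by a set of levels that is dense from the
left, is the family of cuts of a fuzzy set up to taking left limits. -/
theorem exists_mem_USCG_cut_eq [T2Space X] {S : Set ℝ} (hS01 : S ⊆ Ioc 0 1)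
    (hS : ∀ a b : ℝ, 0 ≤ a → a < b → b ≤ 1 → ∃ s ∈ S, s ∈ Ioo a b)
    (K : ℝ → NonemptyCompacts X) (hK : ∀ α ∈ S, ∀ β ∈ S, α ≤ β → K β ≤ K α) :
    ∃ u ∈ USCG X, ∀ α ∈ Ioc (0 : ℝ) 1, cut u α = ⋂ β : {β // β ∈ S ∧ β < α}, (K β : Set X) := by
  set L : X → Set ℝ := fun x => {β | β ∈ S ∧ x ∈ K β}
  have hbdd : ∀ x, BddAbove (L x) := fun x => ⟨1, fun β hβ => (hS01 hβ.1).2⟩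
  have hmem : ∀ x, sSup (L x) ∈ Icc (0 : ℝ) 1 := fun x =>
    ⟨Real.sSup_nonneg fun β hβ => (hS01 hβ.1).1.le,
      Real.sSup_le (fun β hβ => (hS01 hβ.1).2) zero_le_one⟩
  -- A point lying in no `K β` gets the value 0, because `sSup ∅ = 0` in ℝ.
  let u : FuzzySet X := fun x => ⟨sSup (L x), hmem x⟩
  have hcut : ∀ α ∈ Ioc (0 : ℝ) 1,
      cut u α = ⋂ β : {β // β ∈ S ∧ β < α}, (K β : Set X) := by
    intro α hα
    rw [cut_of_pos _ hα.1]
    ext x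
    simp only [mem_ofPred_eq, mem_iInter, Subtype.forall, and_imp]
    constructor
    · intro h β hβ hβα
      have hne : (L x).Nonempty := by
        by_contra hne
        have : sSup (L x) = 0 := by rw [not_nonempty_iff_eq_empty.1 hne, Real.sSup_empty]
        have h' : α ≤ sSup (L x) := h
        linarith [hα.1]
      obtain ⟨γ, hγ, hβγ⟩ := exists_lt_of_lt_csSup hne (hβα.trans_le h)
      exact hK β hβ γ hγ.1 hβγ.le hγ.2
    · intro h
      by_contra! hlt
      obtain ⟨β, hβ, h1, h2⟩ := hS _ _ (hmem x).1 hlt hα.2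
      exact absurd h1 (not_lt.2 (le_csSup (hbdd x) ⟨hβ, h β hβ h2⟩))
  refine ⟨u, fun α hα => ?_, hcut⟩
  rw [hcut α hα]
  obtain ⟨s, hs, hs'⟩ := hS 0 α le_rfl hα.1 hα.2
  have : Nonempty {β // β ∈ S ∧ β < α} := ⟨⟨s, hs, hs'.2⟩⟩
  refine ⟨IsCompact.nonempty_iInter_of_directed_nonempty_isCompact_isClosed _ ?_
    (fun i => (K i).nonempty) (fun i => (K i).isCompact) (fun i => (K i).isCompact.isClosed), ?_⟩
  · intro β γ
    rcases le_total β.1 γ.1 with h | h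
    · exact ⟨γ, hK _ β.2.1 _ γ.2.1 h, subset_rfl⟩
    · exact ⟨β, subset_rfl, hK _ γ.2.1 _ β.2.1 h⟩
  · exact (K s).isCompact.of_isClosed_subset (isClosed_iInter fun i => (K i).isCompact.isClosed)
      (iInter_subset _ (⟨s, hs, hs'.2⟩ : {β // β ∈ S ∧ β < α}))

end Cuts

/-! ### Left continuity of cuts and measurability -/

section CompactCuts

variable {X : Type*} [MetricSpace X]

/-- The cuts of a member of `USCG X` as nonempty compact sets; outside `(0,1]` the cut at level `1`
is used. -/
noncomputable def cutCompact {u : FuzzySet X} (hu : u ∈ USCG X) (α : ℝ) : NonemptyCompacts X :=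
  open Classical in
  if h : α ∈ Ioc (0 : ℝ) 1 then ⟨⟨cut u α, (hu α h).2⟩, (hu α h).1⟩
  else ⟨⟨cut u 1, (hu 1 (by simp)).2⟩, (hu 1 (by simp)).1⟩

theorem coe_cutCompact {u : FuzzySet X} (hu : u ∈ USCG X) {α : ℝ} (hα : α ∈ Ioc (0 : ℝ) 1) :
    (cutCompact hu α : Set X) = cut u α := by
  rw [cutCompact, dif_pos hα]; rfl

theorem edist_cutCompact {u v : FuzzySet X} (hu : u ∈ USCG X) (hv : v ∈ USCG X) {α β : ℝ}
    (hα : α ∈ Ioc (0 : ℝ) 1) (hβ : β ∈ Ioc (0 : ℝ) 1) :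
    edist (cutCompact hu α) (cutCompact hv β) = hausdorffEDist (cut u α) (cut v β) := by
  rw [← coe_cutCompact hu hα, ← coe_cutCompact hv hβ]
  rfl

theorem cutDist_eq_edist {u v : FuzzySet X} (hu : u ∈ USCG X) (hv : v ∈ USCG X) {α : ℝ}
    (hα : α ∈ Ioc (0 : ℝ) 1) : cutDist u v α = edist (cutCompact hu α) (cutCompact hv α) :=
  (edist_cutCompact hu hv hα hα).symm

/-- The cuts below level α decrease to the cut at α, so by compactness one of them already lies in
its ε-thickening; the other half of the Hausdorff bound is mere inclusion. -/
theorem exists_forall_hausdorffEDist_cut_le {u : FuzzySet X} (hu : u ∈ USCG X) {α : ℝ}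
    (hα : α ∈ Ioc (0 : ℝ) 1) {ε : ℝ} (hε : 0 < ε) :
    ∃ γ ∈ Ioo 0 α, ∀ β ∈ Icc γ α, hausdorffEDist (cut u β) (cut u α) ≤ ENNReal.ofReal ε := by
  have hI : ∀ β : Ioo 0 α, (β : ℝ) ∈ Ioc (0 : ℝ) 1 := fun β => ⟨β.2.1, β.2.2.le.trans hα.2⟩
  have : Nonempty (Ioo 0 α) := ⟨⟨α / 2, half_pos hα.1, half_lt_self hα.1⟩⟩
  obtain ⟨γ, hγ⟩ := exists_subset_nhds_of_isCompact' (V := fun β : Ioo 0 α => cut u β)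
    (U := thickening ε (cut u α))
    (fun β γ => by
      rcases le_total β.1 γ.1 with h | h
      · exact ⟨γ, cut_anti u β.2.1.le h, subset_rfl⟩
      · exact ⟨β, subset_rfl, cut_anti u γ.2.1.le h⟩)
    (fun β => (hu _ (hI β)).2) (fun β => (hu _ (hI β)).2.isClosed)
    (fun x hx => by
      have : x ∈ cut u α := mem_cut_of_forall_lt u hα.1 fun β hβ => mem_iInter.1 hx ⟨β, hβ⟩
      exact isOpen_thickening.mem_nhds (self_subset_thickening hε _ this))
  refine ⟨γ, γ.2, fun β hβ => hausdorffEDist_le_of_infEDist (fun x hx => ?_) fun x hx => ?_⟩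
  · exact (hγ (cut_anti u γ.2.1.le hβ.1 hx)).le
  · rw [infEDist_zero_of_mem (cut_anti u (γ.2.1.le.trans hβ.1) hβ.2 hx)]
    exact zero_le

/-- The cuts depend left-continuously on the level. -/
theorem tendsto_cutCompact {u : FuzzySet X} (hu : u ∈ USCG X) {α : ℝ} (hα : α ∈ Ioc (0 : ℝ) 1) :
    Tendsto (cutCompact hu) (𝓝[≤] α) (𝓝 (cutCompact hu α)) := by
  rw [EMetric.tendsto_nhds]
  intro ε hε
  obtain ⟨δ, hδ0, hδ⟩ : ∃ δ : ℝ, 0 < δ ∧ ENNReal.ofReal δ < ε := by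
    obtain ⟨r, hr, hr'⟩ := ENNReal.lt_iff_exists_real_btwn.1 hε
    exact ⟨r, ENNReal.ofReal_pos.1 hr'.1, hr'.2⟩
  obtain ⟨γ, hγ, h⟩ := exists_forall_hausdorffEDist_cut_le hu hα hδ0
  filter_upwards [Ioc_mem_nhdsLE hγ.2] with β hβ
  rw [edist_cutCompact hu hu ⟨hγ.1.trans hβ.1, hβ.2.trans hα.2⟩ hα]
  exact (h β ⟨hβ.1.le, hβ.2⟩).trans_lt hδ

/-- The largest multiple of `1 / (n + 1)` that is smaller than `α`. -/
noncomputable def grid (n : ℕ) (α : ℝ) : ℝ := (⌈((n : ℝ) + 1) * α⌉ - 1) / ((n : ℝ) + 1)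

theorem grid_lt (n : ℕ) (α : ℝ) : grid n α < α := by
  have hn : (0 : ℝ) < n + 1 := by positivity
  rw [grid, div_lt_iff₀ hn]
  linarith [Int.ceil_lt_add_one (((n : ℝ) + 1) * α)]

theorem sub_le_grid (n : ℕ) (α : ℝ) : α - 1 / ((n : ℝ) + 1) ≤ grid n α := by
  have hn : (0 : ℝ) < n + 1 := by positivity
  rw [grid, le_div_iff₀ hn, sub_mul, one_div_mul_cancel hn.ne']
  linarith [Int.le_ceil (((n : ℝ) + 1) * α)]

theorem tendsto_grid (α : ℝ) : Tendsto (fun n => grid n α) atTop (𝓝[≤] α) := by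
  refine tendsto_nhdsWithin_iff.2 ⟨?_, Eventually.of_forall fun n => (grid_lt n α).le⟩
  refine tendsto_of_tendsto_of_tendsto_of_le_of_le (g := fun n : ℕ => α - 1 / ((n : ℝ) + 1)) ?_
    tendsto_const_nhds (fun n => sub_le_grid n α) fun n => (grid_lt n α).le
  simpa using tendsto_const_nhds.sub (tendsto_one_div_add_atTop_nhds_zero_nat (𝕜 := ℝ))

theorem tendsto_cutCompact_grid {u : FuzzySet X} (hu : u ∈ USCG X) {α : ℝ}
    (hα : α ∈ Ioc (0 : ℝ) 1) :
    Tendsto (fun n => cutCompact hu (grid n α)) atTop (𝓝 (cutCompact hu α)) :=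
  (tendsto_cutCompact hu hα).comp (tendsto_grid α)

/-- Evaluated at `grid n α`, the distance depends on α only through an integer ceiling, so it is
measurable; left continuity gives pointwise convergence on (0,1]. Level 0 is split off, as nothing
is continuous there. -/
theorem measurable_cutDist {u v : FuzzySet X} (hu : u ∈ USCG X) (hv : v ∈ USCG X) :
    Measurable fun α : Icc (0 : ℝ) 1 => cutDist u v α := by
  classical
  let g : ℝ → ℝ≥0∞ := fun α => edist (cutCompact hu α) (cutCompact hv α)
  let G : ℝ → ℝ≥0∞ := fun α => if α ∈ Ioc (0 : ℝ) 1 then g α else cutDist u v 0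
  have hG : Measurable G := by
    refine measurable_of_tendsto_metrizable (f := fun n (α : ℝ) =>
      if α ∈ Ioc (0 : ℝ) 1 then g (grid n α) else cutDist u v 0) (fun n => ?_)
      (tendsto_pi_nhds.2 fun α => ?_)
    · refine Measurable.ite measurableSet_Ioc ?_ measurable_const
      exact (measurable_from_top (f := fun z : ℤ => g ((z - 1) / ((n : ℝ) + 1)))).comp
        (Int.measurable_ceil.comp (measurable_const_mul _))
    · by_cases hα : α ∈ Ioc (0 : ℝ) 1
      · simp only [G, hα, if_true]
        exact (tendsto_cutCompact_grid hu hα).edist (tendsto_cutCompact_grid hv hα)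
      · simp only [G, hα, if_false]
        exact tendsto_const_nhds
  convert hG.comp measurable_subtype_coe using 1
  funext α
  rcases α.2.1.eq_or_lt with h | h
  · simp [G, ← h]
  · have : (α : ℝ) ∈ Ioc (0 : ℝ) 1 := ⟨h, α.2.2⟩
    simp only [G, Function.comp, this, if_true]
    exact cutDist_eq_edist hu hv this

end CompactCuts

end FuzzySet

namespace FuzzySet

open Set Filter Topology Metric TopologicalSpace

/-! ### The metric axioms for `dp` -/

section Metric

variable {X : Type*} [MetricSpace X] {p : ℝ}

theorem ae_mem_Ioc : ∀ᵐ α ∂volume.restrict (Icc (0 : ℝ) 1), α ∈ Ioc (0 : ℝ) 1 := by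
  rw [← restrict_Ioc_eq_restrict_Icc]
  exact ae_restrict_mem measurableSet_Ioc

theorem exists_mem_Ioo_of_ae {P : ℝ → Prop} (hP : ∀ᵐ α ∂volume.restrict (Icc (0 : ℝ) 1), P α)
    {a b : ℝ} (ha : 0 ≤ a) (hab : a < b) (hb : b ≤ 1) : ∃ s, P s ∧ s ∈ Ioo a b := by
  have h : ∀ᵐ α ∂volume.restrict (Ioo a b), P α ∧ α ∈ Ioo a b :=
    (ae_restrict_of_ae_restrict_of_subset
      (Ioo_subset_Icc_self.trans (Icc_subset_Icc ha hb)) hP).and (ae_restrict_mem measurableSet_Ioo)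
  have : (ae (volume.restrict (Ioo a b))).NeBot := by
    rw [ae_neBot, Ne, Measure.restrict_eq_zero, Real.volume_Ioo]
    simpa using hab
  exact h.exists

theorem aemeasurable_cutDist {u v : FuzzySet X} (hu : u ∈ USCG X) (hv : v ∈ USCG X) :
    AEMeasurable (cutDist u v) (volume.restrict (Icc (0 : ℝ) 1)) :=
  aemeasurable_restrict_of_measurable_subtype measurableSet_Icc (measurable_cutDist hu hv)

theorem cutDist_comm (u v : FuzzySet X) (α : ℝ) : cutDist u v α = cutDist v u α :=
  hausdorffEDist_comm

theorem cutDist_triangle (u v w : FuzzySet X) (α : ℝ) :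
    cutDist u w α ≤ cutDist u v α + cutDist v w α :=
  hausdorffEDist_triangle

theorem dp_comm (u v : FuzzySet X) : dp p u v = dp p v u := by
  simp only [dp, cutDist_comm u v]

theorem dp_self (hp : 1 ≤ p) (u : FuzzySet X) : dp p u u = 0 := by
  have h0 : 0 < p := zero_lt_one.trans_le hp
  simp [dp, cutDist, h0]

theorem dp_triangle (hp : 1 ≤ p) {u v w : FuzzySet X} (hu : u ∈ USCG X) (hv : v ∈ USCG X)
    (hw : w ∈ USCG X) : dp p u w ≤ dp p u v + dp p v w := by
  have h0 : 0 < p := zero_lt_one.trans_le hp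
  refine le_trans ?_ (ENNReal.lintegral_Lp_add_le (aemeasurable_cutDist hu hv)
    (aemeasurable_cutDist hv hw) hp)
  refine ENNReal.rpow_le_rpow (lintegral_mono fun α => ?_) (by positivity)
  exact ENNReal.rpow_le_rpow (cutDist_triangle u v w α) h0.le

theorem dp_rpow (hp : 1 ≤ p) (u v : FuzzySet X) :
    dp p u v ^ p = ∫⁻ α in Icc (0 : ℝ) 1, cutDist u v α ^ p := by
  rw [dp, one_div, ENNReal.rpow_inv_rpow (by linarith)]

theorem dp_congr {Y : Type*} [MetricSpace Y] {u v : FuzzySet X} {u' v' : FuzzySet Y}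
    (h : ∀ α ∈ Ioc (0 : ℝ) 1, cutDist u v α = cutDist u' v' α) : dp p u v = dp p u' v' := by
  rw [dp, dp, lintegral_congr_ae]
  filter_upwards [ae_mem_Ioc] with α hα
  rw [h α hα]

theorem dp_le_of_forall_le (hp : 1 ≤ p) {u v : FuzzySet X} {C : ℝ≥0∞}
    (h : ∀ α ∈ Ioc (0 : ℝ) 1, cutDist u v α ≤ C) : dp p u v ≤ C := by
  have h0 : 0 < p := zero_lt_one.trans_le hp
  rw [dp, one_div, ENNReal.rpow_inv_le_iff h0]
  calc ∫⁻ α in Icc (0 : ℝ) 1, cutDist u v α ^ p ≤ ∫⁻ _ in Icc (0 : ℝ) 1, C ^ p := by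
        refine lintegral_mono_ae ?_
        filter_upwards [ae_mem_Ioc] with α hα
        exact ENNReal.rpow_le_rpow (h α hα) h0.le
    _ = C ^ p := by simp

theorem eq_of_dp_eq_zero (hp : 1 ≤ p) {u v : FuzzySet X} (hu : u ∈ USCG X) (hv : v ∈ USCG X)
    (h : dp p u v = 0) : u = v := by
  have h0 : 0 < p := zero_lt_one.trans_le hp
  have h1 : ∀ᵐ α ∂volume.restrict (Icc (0 : ℝ) 1), cutDist u v α = 0 := by
    have h2 := dp_rpow hp u v
    rw [h, ENNReal.zero_rpow_of_pos h0, eq_comm,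
      lintegral_eq_zero_iff' ((aemeasurable_cutDist hu hv).pow_const p)] at h2
    filter_upwards [h2] with α hα
    simpa [h0, h0.le, not_lt.2 h0.le] using hα
  refine ext_of_cut (S := {α | cutDist u v α = 0})
    (fun a b ha hab hb => exists_mem_Ioo_of_ae h1 ha hab hb) fun α hα hα' => ?_
  exact ((hu α hα').2.isClosed.hausdorffEDist_zero_iff (hv α hα').2.isClosed).1 hα

/-- All cuts lie in the compact cut at level 0, which bounds the integrand uniformly. -/
theorem dp_point_lt_top (hp : 1 ≤ p) {u : FuzzySet X} (hu : u ∈ USCB X) (x : X) :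
    dp p u (point x) < ∞ := by
  have h0 := hu 0 (by simp)
  refine (dp_le_of_forall_le hp (C := ediam (insert x (cut u 0))) fun α hα => ?_).trans_lt
    (isBounded_iff_ediam_ne_top.1 (h0.2.insert x).isBounded).lt_top
  have hα' := Ioc_subset_Icc_self hα
  rw [cutDist, cut_point x hα']
  refine (hausdorffEDist_le_ediam (hu α hα').1 (singleton_nonempty x)).trans (ediam_mono ?_)
  exact union_subset ((cut_anti u le_rfl hα.1.le).trans (subset_insert _ _)) (by simp)

theorem USCB_subset_USCGp (hp : 1 ≤ p) : USCB X ⊆ USCGp X p := fun u hu => by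
  obtain ⟨x, -⟩ := (hu 0 (by simp)).1
  exact ⟨USCB_subset_USCG hu, x, dp_point_lt_top hp hu x⟩

theorem dp_ne_top (hp : 1 ≤ p) {u v : FuzzySet X} (hu : u ∈ USCGp X p) (hv : v ∈ USCGp X p) :
    dp p u v ≠ ∞ := by
  obtain ⟨hu, x, hx⟩ := hu
  obtain ⟨hv, y, hy⟩ := hv
  have hx' := USCB_subset_USCG (point_mem_USCB x)
  have hy' := USCB_subset_USCG (point_mem_USCB y)
  refine ne_top_of_le_ne_top ?_ ((dp_triangle hp hu hx' hv).trans
    (add_le_add_right (dp_triangle hp hx' hy' hv) _))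
  rw [dp_comm (point y)]
  exact (ENNReal.add_lt_top.2 ⟨hx, ENNReal.add_lt_top.2
    ⟨dp_point_lt_top hp (point_mem_USCB x) y, hy⟩⟩).ne

theorem mem_USCGp_of_dp_ne_top (hp : 1 ≤ p) {u v : FuzzySet X} (hu : u ∈ USCG X)
    (hv : v ∈ USCGp X p) (h : dp p u v ≠ ∞) : u ∈ USCGp X p := by
  obtain ⟨hv, x, hx⟩ := hv
  exact ⟨hu, x, (dp_triangle hp hu hv (USCB_subset_USCG (point_mem_USCB x))).trans_lt
    (ENNReal.add_lt_top.2 ⟨h.lt_top, hx⟩)⟩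

/-- The metric `d_p` on a set of fuzzy sets at finite `d_p`-distance from points. -/
noncomputable abbrev dpMetricSpace (hp : 1 ≤ p) {s : Set (FuzzySet X)} (hs : s ⊆ USCGp X p) :
    MetricSpace s :=
  letI : EMetricSpace s :=
    { edist := fun u v => dp p (u : FuzzySet X) v
      edist_self := fun u => dp_self hp (u : FuzzySet X)
      edist_comm := fun u v => dp_comm (u : FuzzySet X) v
      edist_triangle := fun u v w => dp_triangle hp (hs u.2).1 (hs v.2).1 (hs w.2).1
      eq_of_edist_eq_zero := fun {u v} h =>
        Subtype.ext (eq_of_dp_eq_zero hp (hs u.2).1 (hs v.2).1 h) }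
  EMetricSpace.toMetricSpace fun u v => dp_ne_top hp (hs u.2) (hs v.2)

end Metric

/-! ### Extension by zero -/

section Extension

variable {X Y : Type*} {ι : X → Y} {p : ℝ}

/-- Level 0 is excluded: the closure taken in Y may exceed the image of the closure in X. -/
theorem cut_extendZero [TopologicalSpace X] [TopologicalSpace Y] (hι : Function.Injective ι)
    (u : FuzzySet X) {α : ℝ} (hα : 0 < α) : cut (extendZero ι u) α = ι '' cut u α := by
  rw [cut_of_pos _ hα, cut_of_pos _ hα]
  ext y
  by_cases hy : ∃ x, ι x = y
  · obtain ⟨x, rfl⟩ := hy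
    simp [extendZero, hι.extend_apply, hι.eq_iff]
  · simp only [mem_ofPred_eq, extendZero, Function.extend_apply' _ _ _ hy, mem_image]
    constructor
    · intro h
      exact absurd hα (not_lt.2 h)
    · rintro ⟨x, -, rfl⟩
      exact absurd ⟨x, rfl⟩ hy

theorem extendZero_mem_USCG [TopologicalSpace X] [TopologicalSpace Y] (hι : Function.Injective ι)
    (hc : Continuous ι) {u : FuzzySet X} (hu : u ∈ USCG X) : extendZero ι u ∈ USCG Y :=
  fun α hα => by
    rw [cut_extendZero hι u hα.1]
    exact ⟨(hu α hα).1.image ι, (hu α hα).2.image hc⟩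

variable [MetricSpace X] [MetricSpace Y]

theorem cutDist_extendZero (hι : Isometry ι) (u v : FuzzySet X) {α : ℝ} (hα : 0 < α) :
    cutDist (extendZero ι u) (extendZero ι v) α = cutDist u v α := by
  rw [cutDist, cut_extendZero hι.injective u hα, cut_extendZero hι.injective v hα,
    hausdorffEDist_image hι, cutDist]

theorem dp_extendZero (hι : Isometry ι) (u v : FuzzySet X) :
    dp p (extendZero ι u) (extendZero ι v) = dp p u v :=
  dp_congr fun _ hα => cutDist_extendZero hι u v hα.1

theorem dp_extendZero_point (hι : Isometry ι) (u : FuzzySet X) (x : X) :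
    dp p (extendZero ι u) (point (ι x)) = dp p u (point x) := by
  rw [← dp_extendZero hι u (point x)]
  refine dp_congr fun α hα => ?_
  rw [cutDist, cutDist, cut_extendZero hι.injective (point x) hα.1,
    cut_point _ (Ioc_subset_Icc_self hα), cut_point _ (Ioc_subset_Icc_self hα), image_singleton]

theorem extendZero_mem_USCGp (hι : Isometry ι) {u : FuzzySet X} (hu : u ∈ USCGp X p) :
    extendZero ι u ∈ USCGp Y p := by
  obtain ⟨hu, x, hx⟩ := hu
  exact ⟨extendZero_mem_USCG hι.injective hι.continuous hu, ι x, by rwa [dp_extendZero_point hι]⟩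

end Extension

end FuzzySet

namespace FuzzySet

open Set Filter Topology Metric TopologicalSpace

/-! ### Density of `USCB X` -/

section Density

variable {X : Type*} [MetricSpace X] {p : ℝ}

theorem tendsto_dp_of_dominated (hp : 1 ≤ p) {u : FuzzySet X} (hu : u ∈ USCG X)
    {v : ℕ → FuzzySet X} (hv : ∀ n, v n ∈ USCG X) (g : ℝ → ℝ≥0∞)
    (hg : ∫⁻ α in Icc (0 : ℝ) 1, g α ^ p ≠ ∞)
    (hle : ∀ n, ∀ α ∈ Ioc (0 : ℝ) 1, cutDist (v n) u α ≤ g α)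
    (hlim : ∀ α ∈ Ioc (0 : ℝ) 1, Tendsto (fun n => cutDist (v n) u α) atTop (𝓝 0)) :
    Tendsto (fun n => dp p (v n) u) atTop (𝓝 0) := by
  have h0 : 0 < p := zero_lt_one.trans_le hp
  have h := tendsto_lintegral_of_dominated_convergence' (fun α => g α ^ p)
    (μ := volume.restrict (Icc (0 : ℝ) 1)) (F := fun n α => cutDist (v n) u α ^ p)
    (f := fun _ => 0) (fun n => (aemeasurable_cutDist (hv n) hu).pow_const p)
    (fun n => by
      filter_upwards [ae_mem_Ioc] with α hα
      exact ENNReal.rpow_le_rpow (hle n α hα) h0.le) hg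
    (by
      filter_upwards [ae_mem_Ioc] with α hα
      simpa [h0] using (hlim α hα).ennrpow_const p)
  simpa [dp, h0] using h.ennrpow_const (1 / p)

theorem hausdorffEDist_singleton_mono {s t : Set X} (hst : s ⊆ t) (hs : s.Nonempty) (x : X) :
    hausdorffEDist s {x} ≤ hausdorffEDist t {x} := by
  have key : ∀ y ∈ t, edist y x ≤ hausdorffEDist t {x} := fun y hy => by
    simpa using infEDist_le_hausdorffEDist_of_mem (t := {x}) hy
  obtain ⟨z, hz⟩ := hs
  refine hausdorffEDist_le_of_mem_edist (fun y hy => ⟨x, rfl, key y (hst hy)⟩) ?_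
  rintro _ rfl
  exact ⟨z, hz, by rw [edist_comm]; exact key z (hst hz)⟩

/-- The fuzzy set obtained from `u` by replacing the values smaller than `δ` by `0`. -/
noncomputable def truncate (δ : ℝ) (u : FuzzySet X) : FuzzySet X := fun x =>
  open Classical in if δ ≤ (u x : ℝ) then u x else 0

theorem cut_truncate (δ : ℝ) (u : FuzzySet X) {α : ℝ} (hα : 0 < α) :
    cut (truncate δ u) α = cut u (max α δ) := by
  rw [cut_of_pos _ hα, cut_of_pos _ (lt_max_of_lt_left hα)]
  ext x
  by_cases h : δ ≤ (u x : ℝ) <;> simp [truncate, h, hα]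

theorem truncate_mem_USCB {δ : ℝ} (hδ : δ ∈ Ioc (0 : ℝ) 1) {u : FuzzySet X} (hu : u ∈ USCG X) :
    truncate δ u ∈ USCB X := by
  intro α hα
  rcases hα.1.eq_or_lt with rfl | h0
  · have : {x | 0 < (truncate δ u x : ℝ)} = cut u δ := by
      rw [cut_of_pos u hδ.1]
      ext x
      by_cases h : δ ≤ (u x : ℝ)
      · simpa [truncate, h] using hδ.1.trans_le h
      · simp [truncate, h]
    rw [cut_zero, this, (hu δ hδ).2.isClosed.closure_eq]
    exact hu δ hδ
  · rw [cut_truncate δ u h0]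
    exact hu _ ⟨lt_max_of_lt_left h0, max_le hα.2 hδ.2⟩

theorem exists_mem_USCB_dp_lt (hp : 1 ≤ p) {u : FuzzySet X} (hu : u ∈ USCGp X p) {ε : ℝ≥0∞}
    (hε : 0 < ε) : ∃ w ∈ USCB X, dp p w u < ε := by
  have h0 : 0 < p := zero_lt_one.trans_le hp
  obtain ⟨hu, x, hx⟩ := hu
  have hδ : ∀ n : ℕ, 1 / ((n : ℝ) + 1) ∈ Ioc (0 : ℝ) 1 := fun n =>
    ⟨by positivity, by rw [div_le_one (by positivity)]; linarith [n.cast_nonneg (α := ℝ)]⟩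
  have hw : ∀ n : ℕ, truncate (1 / ((n : ℝ) + 1)) u ∈ USCB X := fun n =>
    truncate_mem_USCB (hδ n) hu
  -- Truncation only shrinks cuts, so both cuts are within `cutDist u (point x) α` of `{x}`; at a
  -- fixed level truncation eventually changes nothing.
  have hlim := tendsto_dp_of_dominated hp hu (fun n => USCB_subset_USCG (hw n))
    (fun α => 2 * cutDist u (point x) α) ?_ ?_ ?_
  · obtain ⟨n, hn⟩ := (hlim.eventually (gt_mem_nhds hε)).exists
    exact ⟨_, hw n, hn⟩
  · simp_rw [ENNReal.mul_rpow_of_nonneg _ _ h0.le]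
    rw [lintegral_const_mul' _ _ (ENNReal.rpow_ne_top_of_nonneg h0.le (by simp)), ← dp_rpow hp]
    exact ENNReal.mul_ne_top (ENNReal.rpow_ne_top_of_nonneg h0.le (by simp))
      (ENNReal.rpow_ne_top_of_nonneg h0.le hx.ne)
  · intro n α hα
    have hm : max α (1 / ((n : ℝ) + 1)) ∈ Ioc (0 : ℝ) 1 :=
      ⟨lt_max_of_lt_left hα.1, max_le hα.2 (hδ n).2⟩
    rw [cutDist, cut_truncate _ u hα.1, cutDist, cut_point x (Ioc_subset_Icc_self hα),
      two_mul]
    refine hausdorffEDist_triangle.trans (add_le_add (hausdorffEDist_singleton_mono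
      (cut_anti u hα.1.le (le_max_left _ _)) (hu _ hm).1 x) ?_)
    rw [hausdorffEDist_comm]
  · intro α hα
    refine tendsto_const_nhds.congr' ?_
    filter_upwards [(tendsto_one_div_add_atTop_nhds_zero_nat (𝕜 := ℝ)).eventually
      (gt_mem_nhds hα.1)] with n hn
    rw [cutDist, cut_truncate _ u hα.1, max_eq_left hn.le, hausdorffEDist_self]

theorem grid_nonneg (n : ℕ) {α : ℝ} (hα : 0 < α) : 0 ≤ grid n α := by
  have hn : (0 : ℝ) < n + 1 := by positivity
  refine div_nonneg ?_ hn.le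
  have : 1 ≤ ⌈((n : ℝ) + 1) * α⌉ := Int.one_le_ceil_iff.2 (mul_pos hn hα)
  have : (1 : ℝ) ≤ ⌈((n : ℝ) + 1) * α⌉ := by exact_mod_cast this
  linarith

theorem tendsto_hausdorffEDist_cut_grid {u : FuzzySet X} (hu : u ∈ USCG X) {α : ℝ}
    (hα : α ∈ Ioc (0 : ℝ) 1) :
    Tendsto (fun n => hausdorffEDist (cut u (grid n α)) (cut u α)) atTop (𝓝 0) := by
  refine (tendsto_iff_edist_tendsto_0.1 (tendsto_cutCompact_grid hu hα)).congr' ?_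
  filter_upwards [((tendsto_grid α).mono_right nhdsWithin_le_nhds).eventually
    (lt_mem_nhds hα.1)] with n hn
  exact edist_cutCompact hu hu ⟨hn, (grid_lt n α).le.trans hα.2⟩ hα

/-- Take a finite ε/2-net of K and move each of its points by less than ε/2 into the range of ι. -/
theorem exists_finset_hausdorffEDist_image_le {X Y : Type*} [MetricSpace Y] {ι : X → Y}
    (hd : DenseRange ι) {K : Set Y} (hK : IsCompact K)
    {ε : ℝ} (hε : 0 < ε) :
    ∃ B : Finset X, hausdorffEDist (ι '' (B : Set X)) K ≤ ENNReal.ofReal ε := by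
  classical
  obtain ⟨t, htK, htf, hcov⟩ := hK.finite_cover_balls (half_pos hε)
  choose f hf using fun y => hd.exists_dist_lt y (half_pos hε)
  refine ⟨htf.toFinset.image f, hausdorffEDist_le_of_mem_edist ?_ ?_⟩
  · rintro _ ⟨x, hx, rfl⟩
    obtain ⟨y, hy, rfl⟩ : ∃ y ∈ t, f y = x := by simpa using hx
    refine ⟨y, htK hy, ?_⟩
    rw [edist_dist, dist_comm]
    exact ENNReal.ofReal_le_ofReal ((hf y).le.trans (half_le_self hε.le))
  · intro z hz
    obtain ⟨y, hy, hzy⟩ := mem_iUnion₂.1 (hcov hz)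
    refine ⟨ι (f y), mem_image_of_mem _ (by simpa using ⟨y, hy, rfl⟩), ?_⟩
    rw [edist_dist]
    refine ENNReal.ofReal_le_ofReal ((dist_triangle z y _).trans ?_)
    linarith [hf y, mem_ball.1 hzy]

variable {Y : Type*} [MetricSpace Y] {ι : X → Y}

/-- Finitely many finite sets, superposed at finitely many levels, form a fuzzy set with compact
cuts. -/
theorem exists_mem_USCB_cut_eq_iUnion {n : ℕ} (B : Fin (n + 1) → Finset X)
    (hB : ∀ k, (B k).Nonempty) : ∃ v ∈ USCB X, ∀ α ∈ Ioc (0 : ℝ) 1,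
      cut v α = ⋃ k : {k : Fin (n + 1) // α ≤ ((k : ℕ) + 1) / ((n : ℝ) + 1)}, (B k : Set X) := by
  classical
  have hn : (0 : ℝ) < n + 1 := by positivity
  let level : Fin (n + 1) → I := fun k => ⟨((k : ℕ) + 1) / ((n : ℝ) + 1), by positivity, by
    rw [div_le_one hn]
    exact_mod_cast k.2⟩
  let v : FuzzySet X := fun x => (Finset.univ.filter fun k => x ∈ B k).sup level
  have hmem : ∀ x (α : ℝ), α ∈ Ioc (0 : ℝ) 1 →
      (α ≤ v x ↔ ∃ k, x ∈ B k ∧ α ≤ ((k : ℕ) + 1) / ((n : ℝ) + 1)) := by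
    intro x α hα
    -- In a linear order a finite supremum is attained; `0 < α` rules out the empty supremum.
    have h := Finset.le_sup_iff (s := Finset.univ.filter fun k => x ∈ B k) (f := level)
      (a := (⟨α, hα.1.le, hα.2⟩ : I)) hα.1
    have h1 : α ≤ v x ↔ (⟨α, hα.1.le, hα.2⟩ : I) ≤ v x := Iff.rfl
    rw [h1, h]
    simp [level, ← Subtype.coe_le_coe]
  have hcut : ∀ α ∈ Ioc (0 : ℝ) 1, cut v α =
      ⋃ k : {k : Fin (n + 1) // α ≤ ((k : ℕ) + 1) / ((n : ℝ) + 1)}, (B k : Set X) := by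
    intro α hα
    rw [cut_of_pos v hα.1]
    ext x
    simp [hmem x α hα, and_comm]
  have hfin : {x | 0 < (v x : ℝ)}.Finite := by
    refine (Finset.univ.biUnion B).finite_toSet.subset fun x hx => ?_
    obtain ⟨k, hk, -⟩ := (hmem x (v x) ⟨hx, (v x).2.2⟩).1 le_rfl
    simpa using ⟨k, hk⟩
  have h1 : (cut v 1).Nonempty := by
    rw [hcut 1 (by simp)]
    obtain ⟨x, hx⟩ := hB (Fin.last n)
    exact ⟨x, mem_iUnion.2 ⟨⟨Fin.last n, by simp [hn.ne']⟩, hx⟩⟩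
  refine ⟨v, fun α hα => ⟨h1.mono (cut_anti v hα.1 hα.2), ?_⟩, hcut⟩
  have h0 : cut v 0 = {x | 0 < (v x : ℝ)} := by rw [cut_zero, hfin.isClosed.closure_eq]
  exact (hfin.subset (h0 ▸ cut_anti v le_rfl hα.1)).isCompact

/-- The finite set `B k` approximates the cut of w at k/(n+1) but is placed at level (k+1)/(n+1).
Both cuts become unions over the same k, and the Hausdorff distance of unions is at most the
supremum of the distances. Since k = 0 uses level 0, w must be in `USCB`. -/
theorem exists_mem_USCB_forall_hausdorffEDist_le (hd : DenseRange ι) {w : FuzzySet Y}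
    (hw : w ∈ USCB Y) (n : ℕ) : ∃ v ∈ USCB X, ∀ α ∈ Ioc (0 : ℝ) 1,
      hausdorffEDist (ι '' cut v α) (cut w (grid n α)) ≤ ENNReal.ofReal (1 / ((n : ℝ) + 1)) := by
  have hn : (0 : ℝ) < n + 1 := by positivity
  have hI : ∀ k : Fin (n + 1), ((k : ℕ) : ℝ) / ((n : ℝ) + 1) ∈ Icc (0 : ℝ) 1 := fun k =>
    ⟨by positivity, by rw [div_le_one hn]; exact_mod_cast k.2.le⟩
  choose B hB using fun k : Fin (n + 1) =>
    exists_finset_hausdorffEDist_image_le hd (hw _ (hI k)).2 (one_div_pos.2 hn)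
  have hBne : ∀ k, (B k).Nonempty := fun k => by
    have := nonempty_of_hausdorffEDist_ne_top (hw _ (hI k)).1 (t := ι '' (B k : Set X))
      (by rw [hausdorffEDist_comm]; exact ((hB k).trans_lt ENNReal.ofReal_lt_top).ne)
    simpa using this
  obtain ⟨v, hv, hcut⟩ := exists_mem_USCB_cut_eq_iUnion B hBne
  refine ⟨v, hv, fun α hα => ?_⟩
  have hgrid : cut w (grid n α) =
      ⋃ k : {k : Fin (n + 1) // α ≤ ((k : ℕ) + 1) / ((n : ℝ) + 1)},
        cut w (((k : Fin (n + 1)) : ℕ) / ((n : ℝ) + 1)) := by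
    refine Subset.antisymm ?_ (iUnion_subset ?_)
    · have h1 : 1 ≤ ⌈((n : ℝ) + 1) * α⌉ := Int.one_le_ceil_iff.2 (mul_pos hn hα.1)
      have h2 : ⌈((n : ℝ) + 1) * α⌉ ≤ n + 1 := by
        rw [Int.ceil_le]
        push_cast
        nlinarith [hα.2]
      obtain ⟨m, hm⟩ := Int.eq_ofNat_of_zero_le (sub_nonneg.2 h1)
      have hm' : (⌈((n : ℝ) + 1) * α⌉ : ℝ) - 1 = m := by exact_mod_cast hm
      -- The index m = ⌈(n+1)α⌉ - 1 is the least admissible k, and its cut is the largest in the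
      -- union.
      refine subset_iUnion_of_subset ⟨⟨m, by omega⟩, ?_⟩ ?_
      · rw [le_div_iff₀ hn]
        linarith [Int.le_ceil (((n : ℝ) + 1) * α)]
      · simp only [grid, hm']
        exact subset_rfl
    · rintro ⟨k, hk⟩
      refine cut_anti w (grid_nonneg n hα.1) ?_
      refine div_le_div_of_nonneg_right ?_ hn.le
      rw [le_div_iff₀ hn, mul_comm] at hk
      have : ⌈((n : ℝ) + 1) * α⌉ ≤ (k : ℕ) + 1 := by
        rw [Int.ceil_le]
        exact_mod_cast hk
      have : (⌈((n : ℝ) + 1) * α⌉ : ℝ) ≤ (k : ℕ) + 1 := by exact_mod_cast this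
      linarith
  rw [hcut α hα, hgrid, image_iUnion]
  exact hausdorffEDist_iUnion_le.trans (iSup_le fun k => hB k)

theorem exists_mem_USCB_dp_extendZero_lt (hι : Isometry ι) (hd : DenseRange ι) (hp : 1 ≤ p)
    {u : FuzzySet Y} (hu : u ∈ USCGp Y p) {ε : ℝ≥0∞} (hε : 0 < ε) :
    ∃ v ∈ USCB X, dp p (extendZero ι v) u < ε := by
  have h0 : 0 < p := zero_lt_one.trans_le hp
  obtain ⟨w, hw, hwu⟩ := exists_mem_USCB_dp_lt hp hu (ENNReal.half_pos hε.ne')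
  choose v hv hvw using exists_mem_USCB_forall_hausdorffEDist_le hd hw
  have hv' : ∀ n, extendZero ι (v n) ∈ USCG Y := fun n =>
    extendZero_mem_USCG hι.injective hι.continuous (USCB_subset_USCG (hv n))
  have hle : ∀ n, ∀ α ∈ Ioc (0 : ℝ) 1, cutDist (extendZero ι (v n)) w α ≤
      ENNReal.ofReal (1 / ((n : ℝ) + 1)) + hausdorffEDist (cut w (grid n α)) (cut w α) := by
    intro n α hα
    rw [cutDist, cut_extendZero hι.injective _ hα.1]
    exact hausdorffEDist_triangle.trans (add_le_add_left (hvw n α hα) _)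
  have hlim := tendsto_dp_of_dominated hp (USCB_subset_USCG hw) hv'
    (fun _ => 1 + ediam (cut w 0)) ?_ ?_ ?_
  · obtain ⟨n, hn⟩ := (hlim.eventually (gt_mem_nhds (ENNReal.half_pos hε.ne'))).exists
    refine ⟨v n, hv n, (dp_triangle hp (hv' n) (USCB_subset_USCG hw) hu.1).trans_lt ?_⟩
    exact (ENNReal.add_lt_add hn hwu).trans_eq (ENNReal.add_halves ε)
  · have := isBounded_iff_ediam_ne_top.1 (hw 0 (by simp)).2.isBounded
    simpa using ENNReal.rpow_ne_top_of_nonneg h0.le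
      (ENNReal.add_ne_top.2 ⟨ENNReal.one_ne_top, this⟩)
  · intro n α hα
    refine (hle n α hα).trans (add_le_add ?_ ?_)
    · rw [← ENNReal.ofReal_one]
      refine ENNReal.ofReal_le_ofReal ?_
      rw [div_le_one (by positivity)]
      linarith [n.cast_nonneg (α := ℝ)]
    · have hg0 := grid_nonneg n hα.1
      have hg1 : grid n α ∈ Icc (0 : ℝ) 1 := ⟨hg0, (grid_lt n α).le.trans hα.2⟩
      refine (hausdorffEDist_le_ediam (hw _ hg1).1 (hw _ (Ioc_subset_Icc_self hα)).1).trans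
        (ediam_mono (union_subset (cut_anti w le_rfl hg0) (cut_anti w le_rfl hα.1.le)))
  · intro α hα
    refine tendsto_of_tendsto_of_tendsto_of_le_of_le tendsto_const_nhds ?_
      (fun _ => zero_le) (fun n => hle n α hα)
    have h1 := (ENNReal.continuous_ofReal.tendsto _).comp
      (tendsto_one_div_add_atTop_nhds_zero_nat (𝕜 := ℝ))
    simpa using h1.add (tendsto_hausdorffEDist_cut_grid (USCB_subset_USCG hw) hα)

end Density

end FuzzySet

namespace FuzzySet

open Set Filter Topology Metric TopologicalSpace

/-! ### Completeness -/

section Completeness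

variable {X : Type*} [MetricSpace X] {p : ℝ}

/-- A nested family of compact sets is left-continuous at all but countably many levels. -/
theorem countable_setOf_iInter_ne {S : Set ℝ} (hS01 : S ⊆ Ioc 0 1)
    (hS : ∀ a b : ℝ, 0 ≤ a → a < b → b ≤ 1 → ∃ s ∈ S, s ∈ Ioo a b)
    (K : ℝ → NonemptyCompacts X) (hK : ∀ α ∈ S, ∀ β ∈ S, α ≤ β → K β ≤ K α) :
    {α | α ∈ S ∧ ⋂ β : {β // β ∈ S ∧ β < α}, (K β : Set X) ≠ K α}.Countable := by
  obtain ⟨D, hDc, hD⟩ : IsSeparable (⋃ β : S, (K β : Set X)) := by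
    choose s hsS hs using fun n : ℕ => hS 0 (1 / ((n : ℝ) + 1)) le_rfl (by positivity)
      (by rw [div_le_one (by positivity)]; linarith [n.cast_nonneg (α := ℝ)])
    refine (IsSeparable.iUnion fun n => (K (s n)).isCompact.isSeparable).mono
      (iUnion_subset fun β => ?_)
    obtain ⟨n, hn⟩ := exists_nat_one_div_lt (hS01 β.2).1
    exact subset_iUnion_of_subset n (hK _ (hsS n) _ β.2 ((hs n).2.trans hn).le)
  -- Each exceptional α is recovered from a ball with centre in D and radius 1/(n+1). Choose it
  -- around a point x of the intersection outside `K α`, small enough to miss `K α`: it meets `K β`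
  -- for all β < α in S and for no β ≥ α, so α is the supremum of the levels where it is met.
  refine ((hDc.prod (countable_univ (α := ℕ))).image fun q => sSup {β | β ∈ S ∧
    ((K β : Set X) ∩ ball q.1 (1 / ((q.2 : ℝ) + 1))).Nonempty}).mono ?_
  rintro α ⟨hα, hne⟩
  have hsub : (K α : Set X) ⊆ ⋂ β : {β // β ∈ S ∧ β < α}, (K β : Set X) :=
    subset_iInter fun β => hK _ β.2.1 _ hα β.2.2.le
  obtain ⟨x, hx, hxα⟩ := exists_of_ssubset (hsub.ssubset_of_ne hne.symm)
  have hx' : ∀ β ∈ S, β < α → x ∈ (K β : Set X) := fun β h1 h2 => mem_iInter.1 hx ⟨β, h1, h2⟩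
  obtain ⟨r, hr, hball⟩ :=
    Metric.mem_nhds_iff.1 ((K α).isCompact.isClosed.isOpen_compl.mem_nhds hxα)
  obtain ⟨n, hn⟩ := exists_nat_one_div_lt (half_pos hr)
  have hxD : x ∈ closure D := by
    obtain ⟨s, hs, hs'⟩ := hS 0 α le_rfl (hS01 hα).1 (hS01 hα).2
    exact hD (mem_iUnion.2 ⟨⟨s, hs⟩, hx' s hs hs'.2⟩)
  obtain ⟨q, hq, hxq⟩ := Metric.mem_closure_iff.1 hxD (1 / ((n : ℝ) + 1)) (by positivity)
  have hU : ball q (1 / ((n : ℝ) + 1)) ⊆ ball x r := fun y hy => by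
    rw [mem_ball] at hy ⊢
    rw [dist_comm] at hxq
    linarith [dist_triangle y q x]
  have hlow : ∀ β ∈ S, β < α → β ∈ {β | β ∈ S ∧
      ((K β : Set X) ∩ ball q (1 / ((n : ℝ) + 1))).Nonempty} :=
    fun β h1 h2 => ⟨h1, x, hx' β h1 h2, hxq⟩
  refine ⟨(q, n), ⟨hq, mem_univ n⟩, csSup_eq_of_forall_le_of_forall_lt_exists_gt ?_ ?_ ?_⟩
  · obtain ⟨s, hs, hs'⟩ := hS 0 α le_rfl (hS01 hα).1 (hS01 hα).2
    exact ⟨s, hlow s hs hs'.2⟩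
  · rintro β ⟨hβ, y, hy, hyU⟩
    by_contra! hlt
    exact hball (hU hyU) (hK _ hα _ hβ hlt.le hy)
  · intro b hb
    obtain ⟨s, hs, hs'⟩ := hS (max b 0) α (le_max_right _ _) (max_lt hb (hS01 hα).1) (hS01 hα).2
    exact ⟨s, hlow s hs hs'.2, (le_max_left _ _).trans_lt hs'.1⟩

/-- If almost all cuts of a sequence of fuzzy sets converge, then they converge to the cuts of a
fuzzy set. -/
theorem exists_ae_tendsto_of_ae_cauchySeq [CompleteSpace X] {u : ℕ → FuzzySet X}
    (hu : ∀ n, u n ∈ USCG X)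
    (h : ∀ᵐ α ∂volume.restrict (Icc (0 : ℝ) 1), CauchySeq fun n => cutCompact (hu n) α) :
    ∃ (v : FuzzySet X) (hv : v ∈ USCG X), ∀ᵐ α ∂volume.restrict (Icc (0 : ℝ) 1),
      Tendsto (fun n => cutCompact (hu n) α) atTop (𝓝 (cutCompact hv α)) := by
  set S : Set ℝ := {α | (CauchySeq fun n => cutCompact (hu n) α) ∧ α ∈ Ioc (0 : ℝ) 1}
  have hSae : ∀ᵐ α ∂volume.restrict (Icc (0 : ℝ) 1), α ∈ S := h.and ae_mem_Ioc
  have hS01 : S ⊆ Ioc 0 1 := fun α hα => hα.2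
  have hS : ∀ a b : ℝ, 0 ≤ a → a < b → b ≤ 1 → ∃ s ∈ S, s ∈ Ioo a b :=
    fun a b ha hab hb => exists_mem_Ioo_of_ae hSae ha hab hb
  have hlim : ∀ α, ∃ K : NonemptyCompacts X, α ∈ S →
      Tendsto (fun n => cutCompact (hu n) α) atTop (𝓝 K) := fun α => by
    by_cases hα : α ∈ S
    · obtain ⟨K, hK⟩ := cauchySeq_tendsto_of_complete hα.1
      exact ⟨K, fun _ => hK⟩
    · exact ⟨cutCompact (hu 0) α, fun h => absurd h hα⟩
  choose K hKlim using hlim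
  have hK : ∀ α ∈ S, ∀ β ∈ S, α ≤ β → K β ≤ K α := by
    intro α hα β hβ hαβ
    -- Inclusion passes to Hausdorff limits because it is an equation in the continuous operation
    -- `⊔`.
    rw [← sup_eq_right]
    refine tendsto_nhds_unique (((hKlim β hβ).sup_nhds (hKlim α hα)).congr fun n => ?_)
      (hKlim α hα)
    rw [sup_eq_right, ← SetLike.coe_subset_coe, coe_cutCompact _ hβ.2, coe_cutCompact _ hα.2]
    exact cut_anti _ hα.2.1.le hαβ
  obtain ⟨v, hv, hcut⟩ := exists_mem_USCG_cut_eq hS01 hS K hK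
  refine ⟨v, hv, ?_⟩
  have hbad := ((countable_setOf_iInter_ne hS01 hS K hK).ae_notMem
    (volume.restrict (Icc (0 : ℝ) 1)))
  filter_upwards [hSae, hbad] with α hα hα'
  have : cutCompact hv α = K α := by
    refine SetLike.coe_injective ?_
    rw [coe_cutCompact hv hα.2, hcut α hα.2]
    by_contra hne
    exact hα' ⟨hα, hne⟩
  rw [this]
  exact hKlim α hα

theorem lintegral_cutDist_le_dp (hp : 1 ≤ p) {u v : FuzzySet X} (hu : u ∈ USCG X)
    (hv : v ∈ USCG X) : ∫⁻ α in Icc (0 : ℝ) 1, cutDist u v α ≤ dp p u v := by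
  have : IsProbabilityMeasure (volume.restrict (Icc (0 : ℝ) 1)) := ⟨by simp⟩
  simpa [eLpNorm', dp] using eLpNorm'_le_eLpNorm'_of_exponent_le zero_lt_one hp
    (volume.restrict (Icc (0 : ℝ) 1)) (aemeasurable_cutDist hu hv).aestronglyMeasurable

/-- On a probability space the L^1 norm is at most the L^p norm, so the sum of consecutive cut
distances has finite integral and is finite almost everywhere. -/
theorem ae_cauchySeq_cutCompact (hp : 1 ≤ p) {u : ℕ → FuzzySet X} (hu : ∀ n, u n ∈ USCG X)
    (h : ∑' n, dp p (u n) (u (n + 1)) ≠ ∞) :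
    ∀ᵐ α ∂volume.restrict (Icc (0 : ℝ) 1), CauchySeq fun n => cutCompact (hu n) α := by
  have hm : ∀ n, AEMeasurable (cutDist (u n) (u (n + 1))) (volume.restrict (Icc (0 : ℝ) 1)) :=
    fun n => aemeasurable_cutDist (hu n) (hu (n + 1))
  have hfin : ∫⁻ α in Icc (0 : ℝ) 1, ∑' n, cutDist (u n) (u (n + 1)) α ≠ ∞ := by
    rw [lintegral_tsum hm]
    exact ne_top_of_le_ne_top h
      (ENNReal.tsum_le_tsum fun n => lintegral_cutDist_le_dp hp (hu n) (hu (n + 1)))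
  filter_upwards [ae_mem_Ioc, ae_lt_top' (AEMeasurable.tsum hm) hfin] with α hα hα'
  exact cauchySeq_of_edist_le_of_tsum_ne_top _
    (fun n => (cutDist_eq_edist (hu n) (hu (n + 1)) hα).ge) hα'.ne

/-- Fatou's lemma for `d_p`. -/
theorem dp_le_of_ae_tendsto (hp : 1 ≤ p) {u : ℕ → FuzzySet X} (hu : ∀ n, u n ∈ USCG X)
    {v w : FuzzySet X} (hv : v ∈ USCG X) (hw : w ∈ USCG X)
    (hlim : ∀ᵐ α ∂volume.restrict (Icc (0 : ℝ) 1),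
      Tendsto (fun n => cutCompact (hu n) α) atTop (𝓝 (cutCompact hv α))) {C : ℝ≥0∞}
    (hC : ∀ᶠ n in atTop, dp p w (u n) ≤ C) : dp p w v ≤ C := by
  have h0 : 0 < p := zero_lt_one.trans_le hp
  rw [← ENNReal.rpow_le_rpow_iff h0, dp_rpow hp]
  calc ∫⁻ α in Icc (0 : ℝ) 1, cutDist w v α ^ p
      = ∫⁻ α in Icc (0 : ℝ) 1, liminf (fun n => cutDist w (u n) α ^ p) atTop := by
        refine lintegral_congr_ae ?_
        filter_upwards [hlim, ae_mem_Ioc] with α hα hα'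
        have h1 := (tendsto_const_nhds (x := cutCompact hw α)).edist hα
        simp_rw [← cutDist_eq_edist hw hv hα', ← cutDist_eq_edist hw (hu _) hα'] at h1
        exact (h1.ennrpow_const p).liminf_eq.symm
    _ ≤ liminf (fun n => ∫⁻ α in Icc (0 : ℝ) 1, cutDist w (u n) α ^ p) atTop :=
        lintegral_liminf_le' fun n => (aemeasurable_cutDist hw (hu n)).pow_const p
    _ ≤ C ^ p := by
        simp_rw [← dp_rpow hp]
        refine liminf_le_of_frequently_le' (Eventually.frequently ?_)
        exact hC.mono fun n hn => ENNReal.rpow_le_rpow hn h0.le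

theorem completeSpace_USCGp [CompleteSpace X] (hp : 1 ≤ p) :
    @CompleteSpace (USCGp X p)
      (dpMetricSpace hp (Subset.refl (USCGp X p))).toPseudoMetricSpace.toUniformSpace := by
  let _ := dpMetricSpace hp (Subset.refl (USCGp X p))
  refine EMetric.complete_of_convergent_controlled_sequences (α := USCGp X p) (fun n => (2⁻¹ : ℝ≥0∞) ^ n)
    (fun n => ENNReal.pow_pos (by simp) n) fun u hB => ?_
  have hB' : ∀ N n m : ℕ, N ≤ n → N ≤ m → dp p (u n : FuzzySet X) (u m) < 2⁻¹ ^ N := hB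
  have hu : ∀ n, (u n : FuzzySet X) ∈ USCG X := fun n => (u n).2.1
  have hsum : ∑' n, dp p (u n : FuzzySet X) (u (n + 1)) ≠ ∞ := by
    refine ne_top_of_le_ne_top ?_
      (ENNReal.tsum_le_tsum fun n => (hB' n n (n + 1) le_rfl n.le_succ).le)
    rw [ENNReal.tsum_geometric]
    simp
  obtain ⟨v, hv, hlim⟩ := exists_ae_tendsto_of_ae_cauchySeq hu (ae_cauchySeq_cutCompact hp hu hsum)
  have hle : ∀ n, dp p (u n : FuzzySet X) v ≤ 2⁻¹ ^ n := fun n =>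
    dp_le_of_ae_tendsto hp hu hv (hu n) hlim
      ((eventually_ge_atTop n).mono fun m hm => (hB' n n m le_rfl hm).le)
  have hv' : v ∈ USCGp X p := mem_USCGp_of_dp_ne_top hp hv (u 0).2 (by
    rw [dp_comm]
    exact ne_top_of_le_ne_top (by simp) (hle 0))
  refine ⟨⟨v, hv'⟩, tendsto_iff_edist_tendsto_0.2 ?_⟩
  exact tendsto_of_tendsto_of_tendsto_of_le_of_le tendsto_const_nhds
    (ENNReal.tendsto_pow_atTop_nhds_zero_of_lt_one (by simp)) (fun _ => zero_le) hle

end Completeness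

/-- Extension by zero exhibits `USCGp Y p` as a completion of any set of fuzzy sets between
`USCB X` and `USCGp X p`. -/
theorem exists_isMetricCompletion_extendZero {X Y : Type*} [MetricSpace X] [MetricSpace Y]
    [CompleteSpace Y] {ι : X → Y} (hι : Isometry ι) (hd : DenseRange ι) {p : ℝ} (hp : 1 ≤ p)
    {s : Set (FuzzySet X)} (hBs : USCB X ⊆ s) (hs : s ⊆ USCGp X p) :
    ∃ i : s → USCGp Y p, (∀ u, (i u : FuzzySet Y) = extendZero ι u) ∧
      IsMetricCompletion (fun u v : s => dp p (u : FuzzySet X) v)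
        (fun u v : USCGp Y p => dp p (u : FuzzySet Y) v) i := by
  refine ⟨fun u => ⟨extendZero ι u, extendZero_mem_USCGp hι (hs u.2)⟩, fun _ => rfl,
    dpMetricSpace hp hs, dpMetricSpace hp Subset.rfl, fun _ _ => rfl, fun _ _ => rfl,
    fun u v => dp_extendZero hι (u : FuzzySet X) v, fun u => ?_, completeSpace_USCGp hp⟩
  let _ := dpMetricSpace hp (Subset.refl (USCGp Y p))
  rw [EMetric.mem_closure_iff]
  intro ε hε
  obtain ⟨v, hv, hvu⟩ := exists_mem_USCB_dp_extendZero_lt hι hd hp u.2 hε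
  refine ⟨_, ⟨⟨v, hBs hv⟩, rfl⟩, ?_⟩
  change dp p (u : FuzzySet Y) (extendZero ι v) < ε
  rwa [dp_comm]

end FuzzySet

theorem theorem7p5 {X Y : Type*} [MetricSpace X] [MetricSpace Y] [CompleteSpace Y]
    (ι : X → Y) (hι : Isometry ι) (hd : DenseRange ι) (p : ℝ) (hp : 1 ≤ p) :
    -- the distance `d_p` is well defined on `F¹_USCG(X)` and on `F¹_USCG(Y)`
    (∀ u ∈ FuzzySet.USCG X, ∀ v ∈ FuzzySet.USCG X,
      Measurable (fun α : Set.Icc (0 : ℝ) 1 => FuzzySet.cutDist u v α)) ∧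
    (∀ u ∈ FuzzySet.USCG Y, ∀ v ∈ FuzzySet.USCG Y,
      Measurable (fun α : Set.Icc (0 : ℝ) 1 => FuzzySet.cutDist u v α)) ∧
    -- `F¹_USCG(Y)^p` is a completion of `F¹_USCB(X)` through extension by zero
    (∃ i : FuzzySet.USCB X → FuzzySet.USCGp Y p,
      (∀ u, (i u : FuzzySet Y) = FuzzySet.extendZero ι u) ∧
      IsMetricCompletion (fun u v : FuzzySet.USCB X => FuzzySet.dp p (u : FuzzySet X) v)
        (fun u v : FuzzySet.USCGp Y p => FuzzySet.dp p (u : FuzzySet Y) v) i) ∧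
    -- `F¹_USCG(Y)^p` is a completion of `F¹_USCG(X)^p` through extension by zero
    (∃ j : FuzzySet.USCGp X p → FuzzySet.USCGp Y p,
      (∀ u, (j u : FuzzySet Y) = FuzzySet.extendZero ι u) ∧
      IsMetricCompletion (fun u v : FuzzySet.USCGp X p => FuzzySet.dp p (u : FuzzySet X) v)
        (fun u v : FuzzySet.USCGp Y p => FuzzySet.dp p (u : FuzzySet Y) v) j) := by
  exact ⟨fun u hu v hv => FuzzySet.measurable_cutDist hu hv,
    fun u hu v hv => FuzzySet.measurable_cutDist hu hv,
    FuzzySet.exists_isMetricCompletion_extendZero hι hd hp subset_rfl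
      (FuzzySet.USCB_subset_USCGp hp),
    FuzzySet.exists_isMetricCompletion_extendZero hι hd hp (FuzzySet.USCB_subset_USCGp hp)
      subset_rfl⟩
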